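/- For positive integers $r,s,t$, let $\Delta(r,s,t)=\langle a,b,c\mid a^2=b^2=c^2=(ab)^r=(bc)^s=(ac)^t=1\rangle$ be the full triangle group. For a set $S$ of positive integers, the natural density of $S$ is $\lim_{x\to\infty}\frac{|S\cap\{1,\dots,x\}|}{x}$, when this limit exists. Then for every triple $(r,s,t)$ of positive integers, the set of orders of the finite quotients of $\Delta(r,s,t)$ has natural density zero (in particular, the limit exists). -/

import Mathlib

open Filter Topology

/-- The relators of the full triangle group: `a ^ 2`, `b ^ 2`, `c ^ 2`, `(a b) ^ r`, `(b c) ^ s`,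
`(a c) ^ t` in the free group on three generators `a`, `b`, `c`. -/
def fullTriangleRels (r s t : ℕ) : Set (FreeGroup (Fin 3)) :=
  let a : FreeGroup (Fin 3) := FreeGroup.of 0
  let b : FreeGroup (Fin 3) := FreeGroup.of 1
  let c : FreeGroup (Fin 3) := FreeGroup.of 2
  {a ^ 2, b ^ 2, c ^ 2, (a * b) ^ r, (b * c) ^ s, (a * c) ^ t}

/-- The full triangle group
`Δ(r, s, t) = ⟨ a, b, c | a ^ 2 = b ^ 2 = c ^ 2 = (a b) ^ r = (b c) ^ s = (a c) ^ t = 1 ⟩`. -/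
abbrev FullTriangleGroup (r s t : ℕ) : Type :=
  PresentedGroup (fullTriangleRels r s t)

/-- The set of orders of the finite quotients `G ⧸ N`, with `N` a normal subgroup, of a group. -/
def finiteQuotientOrders (G : Type*) [Group G] : Set ℕ :=
  {n | ∃ N : Subgroup G, N.Normal ∧ Finite (G ⧸ N) ∧ Nat.card (G ⧸ N) = n}

/-- The set `S` has natural density `d`: the limit of `|S ∩ {1, …, x}| / x` as `x → ∞` exists
and equals `d`. -/
def HasNaturalDensity (S : Set ℕ) (d : ℝ) : Prop :=
  Tendsto (fun x : ℕ => ((S ∩ Set.Icc 1 x).ncard : ℝ) / (x : ℝ)) atTop (𝓝 d)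

/-!
Let `p` be a prime with `p ∤ 2 * r * s * t`, and let `G` be a finite quotient of `Δ(r, s, t)` whose
order `n` is divisible by `p` but not by `p ^ 2`. Then `G` has no normal Sylow `p`-subgroup. Indeed,
let `P` be one; its order is `p`. The three generating involutions centralize or invert `P`, so the
centralizer `C` of `P` has index at most two in `G` and is generated by elements of order dividing
`2 * r * s * t` (`centralizer_le_closure_torsion`). But `P` is central in `C` with index prime to
`p`, so the transfer from `C` to its center does not kill `P`, while its image has exponent dividing
`2 * r * s * t` (`card_dvd_of_closure_torsion`). This contradicts the choice of `p`.

By Sylow's theorems the number of Sylow `p`-subgroups is thus a divisor `d > 1` of `n` with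
`d ≡ 1 [MOD p]`. Almost no integer `n` has, for each of its prime factors `p > M`, such a divisor or
`p ^ 2 ∣ n` (`hasNaturalDensity_zero_of_subset_sylowAmbiguous`): take a threshold `k` of size a large
constant times `log x`. The number of `k`-smooth `n ≤ x` is at most `2 ^ π(k) * √x = o(x)`, because
`π(k) = o(k)`. Any other `n` has a prime factor `p ≥ k` for which `p * p` or `p * (p * j + 1)` with
`j ≥ 1` divides `n`, and the number of such `n ≤ x` is at most `x * (2 + log x) * ∑_{p ≥ k} 1 / p ^ 2`,
a small multiple of `x`.
-/

/-! ### Integers for which Sylow's theorems leave every large prime undecided -/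

/-- The numbers `n` such that, for every prime factor `p > M` of `n`, either `p ^ 2 ∣ n` or `n` has
a divisor `d > 1` with `d ≡ 1 [MOD p]`. Thus for no prime factor `p > M` of `n` does divisibility
alone force a group of order `n` to have a normal Sylow `p`-subgroup of order `p`. -/
def sylowAmbiguous (M : ℕ) : Set ℕ :=
  {n | ∀ p, p.Prime → M < p → p ∣ n → p * p ∣ n ∨ ∃ d, 1 < d ∧ d ∣ n ∧ d ≡ 1 [MOD p]}

/-- The multiples of `p * p` and of the numbers `p * (p * j + 1)`, `j ≥ 1`, in `(0, x]`. -/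
def multiplesUpTo (p x : ℕ) : Finset ℕ :=
  (Finset.Ioc 0 x).filter (p * p ∣ ·) ∪
    (Finset.Icc 1 x).biUnion fun j => (Finset.Ioc 0 x).filter (p * (p * j + 1) ∣ ·)

/-- The terms are at most `x / p ^ 2` and `x / (p ^ 2 * j)`, so a harmonic sum appears. -/
theorem card_multiplesUpTo_le {p : ℕ} (hp : 0 < p) (x : ℕ) :
    ((multiplesUpTo p x).card : ℝ) ≤ x * (2 + Real.log x) * ((p : ℝ) ^ 2)⁻¹ := by
  have hp' : (0 : ℝ) < p := by exact_mod_cast hp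
  have h1 : (((Finset.Ioc 0 x).filter (p * p ∣ ·)).card : ℝ) ≤ x * ((p : ℝ) ^ 2)⁻¹ := by
    rw [Nat.Ioc_filter_dvd_card_eq_div]
    refine Nat.cast_div_le.trans_eq ?_
    push_cast
    rw [div_eq_mul_inv, sq]
  have h2 : (((Finset.Icc 1 x).biUnion
      fun j => (Finset.Ioc 0 x).filter (p * (p * j + 1) ∣ ·)).card : ℝ) ≤
      ∑ j ∈ Finset.Icc 1 x, x * ((p : ℝ) ^ 2)⁻¹ * (j : ℝ)⁻¹ := by
    refine (Nat.cast_le.2 Finset.card_biUnion_le).trans ?_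
    push_cast
    refine Finset.sum_le_sum fun j hj => ?_
    have hj' : (0 : ℝ) < j := by exact_mod_cast (Finset.mem_Icc.1 hj).1
    rw [Nat.Ioc_filter_dvd_card_eq_div]
    refine Nat.cast_div_le.trans ?_
    rw [mul_assoc, ← mul_inv, ← div_eq_mul_inv]
    push_cast
    have : (p : ℝ) ^ 2 * j ≤ p * (p * j + 1) := by nlinarith
    gcongr
  have h3 : ∑ j ∈ Finset.Icc 1 x, (j : ℝ)⁻¹ ≤ 1 + Real.log x := by
    have := harmonic_le_one_add_log x
    rw [harmonic_eq_sum_Icc] at this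
    push_cast at this
    exact this
  rw [← Finset.mul_sum] at h2
  have h4 := mul_le_mul_of_nonneg_left h3 (show 0 ≤ x * ((p : ℝ) ^ 2)⁻¹ by positivity)
  have h5 : ((multiplesUpTo p x).card : ℝ) ≤ _ := Nat.cast_le.2 (Finset.card_union_le _ _)
  push_cast at h5
  linarith

/-- A `k`-rough element of `sylowAmbiguous M` with `M < k` is divisible by a prime `p ≥ k` together
with a cofactor that is `p` itself or a number `d = p * j + 1`, which is coprime to `p`. -/
theorem sylowAmbiguous_inter_subset {M k : ℕ} (hk : M < k) (x : ℕ) :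
    sylowAmbiguous M ∩ Set.Icc 1 x ⊆
      ↑(Nat.smoothNumbersUpTo x k ∪ (Finset.Ioo (k - 1) (x + 1)).biUnion (multiplesUpTo · x)) := by
  rintro n ⟨hn, h1n, hnx⟩
  rw [Finset.mem_coe, Finset.mem_union, or_iff_not_imp_left, Nat.mem_smoothNumbersUpTo,
    Nat.mem_smoothNumbers']
  intro h
  push Not at h
  obtain ⟨p, hp, hpn, hkp⟩ := h hnx
  have hpx : p ≤ x := (Nat.le_of_dvd h1n hpn).trans hnx
  rw [Finset.mem_biUnion]
  refine ⟨p, by simp; omega, ?_⟩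
  simp only [multiplesUpTo, Finset.mem_union, Finset.mem_biUnion, Finset.mem_filter,
    Finset.mem_Ioc, Finset.mem_Icc]
  refine (hn p hp (by omega) hpn).imp (fun h => ⟨⟨h1n, hnx⟩, h⟩) ?_
  rintro ⟨d, h1d, hdn, hd⟩
  obtain ⟨j, hj⟩ := (Nat.modEq_iff_dvd' h1d.le).1 hd.symm
  obtain rfl : d = p * j + 1 := by omega
  have hj0 : 1 ≤ j := Nat.one_le_iff_ne_zero.2 (by rintro rfl; simp at h1d)
  have hjd : j ≤ p * j := Nat.le_mul_of_pos_left j hp.pos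
  have hdx : p * j + 1 ≤ x := (Nat.le_of_dvd h1n hdn).trans hnx
  refine ⟨j, ⟨hj0, by omega⟩, ⟨h1n, hnx⟩, Nat.Coprime.mul_dvd_of_dvd_of_dvd ?_ hpn hdn⟩
  simp

theorem ncard_sylowAmbiguous_inter_le {M k : ℕ} (hk : M < k) (x : ℕ) :
    ((sylowAmbiguous M ∩ Set.Icc 1 x).ncard : ℝ) ≤
      2 ^ Nat.primeCounting (k - 1) * √x + x * (2 + Real.log x) * (2 / k) := by
  have hsub := Set.ncard_le_ncard (sylowAmbiguous_inter_subset hk x) (Finset.finite_toSet _)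
  rw [Set.ncard_coe_finset] at hsub
  have h : ((sylowAmbiguous M ∩ Set.Icc 1 x).ncard : ℝ) ≤ _ :=
    Nat.cast_le.2 (hsub.trans (Finset.card_union_le _ _))
  push_cast at h
  refine h.trans (add_le_add ?_ ?_)
  · refine (Nat.cast_le.2 (Nat.smoothNumbersUpTo_card_le x k)).trans ?_
    push_cast
    have : k.primesBelow.card = Nat.primeCounting (k - 1) := by
      rw [Nat.primesBelow_card_eq_primeCounting', Nat.primeCounting, Nat.sub_add_cancel (by omega)]
    rw [this]
    gcongr
    exact Real.nat_sqrt_le_real_sqrt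
  · refine (Nat.cast_le.2 Finset.card_biUnion_le).trans ?_
    push_cast
    calc ∑ p ∈ Finset.Ioo (k - 1) (x + 1), ((multiplesUpTo p x).card : ℝ)
        ≤ ∑ p ∈ Finset.Ioo (k - 1) (x + 1), x * (2 + Real.log x) * ((p : ℝ) ^ 2)⁻¹ :=
          Finset.sum_le_sum fun p hp => card_multiplesUpTo_le (by simp at hp; omega) x
      _ ≤ x * (2 + Real.log x) * (2 / k) := by
          rw [← Finset.mul_sum]
          have hs := sum_Ioo_inv_sq_le (α := ℝ) (k - 1) (x + 1)
          rw [Nat.cast_sub (by omega : 1 ≤ k)] at hs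
          push_cast at hs
          rw [sub_add_cancel] at hs
          have := Real.log_natCast_nonneg x
          gcongr

theorem eventually_primeCounting_le_mul {δ : ℝ} (hδ : 0 < δ) :
    ∀ᶠ y : ℝ in atTop, (Nat.primeCounting ⌊y⌋₊ : ℝ) ≤ δ * y := by
  have hlog := Real.tendsto_log_atTop.eventually_ge_atTop ((Real.log 4 + 1) / δ)
  filter_upwards [Chebyshev.eventually_primeCounting_le one_pos, hlog, eventually_gt_atTop 1]
    with y hy hl h1
  have hl0 := Real.log_pos h1
  refine hy.trans ?_
  rw [div_le_iff₀ hδ] at hl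
  rw [div_le_iff₀ hl0]
  nlinarith

/-- For `k` just above `log x / (4 * δ)`, the bound of `ncard_sylowAmbiguous_inter_le` divided by `x`
is at most `x ^ (-1 / 4) + 16 * δ` for large `x`, since `π k ≤ δ * k` for large `k`. -/
theorem hasNaturalDensity_zero_of_subset_sylowAmbiguous {S : Set ℕ} {M : ℕ}
    (hS : S ⊆ sylowAmbiguous M) : HasNaturalDensity S 0 := by
  rw [HasNaturalDensity, Metric.tendsto_atTop']
  intro ε hε
  set δ : ℝ := ε / 32 with hδ
  have hδ0 : 0 < δ := by positivity
  -- The cut-off between smooth and rough numbers will be `⌊y x⌋₊ + 1`.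
  set y : ℕ → ℝ := fun x => Real.log x / (4 * δ) with hy
  have hlog : Tendsto (fun x : ℕ => Real.log x) atTop atTop :=
    Real.tendsto_log_atTop.comp tendsto_natCast_atTop_atTop
  have hyt : Tendsto y atTop atTop := hlog.atTop_div_const (by positivity)
  have hpow : Tendsto (fun x : ℕ => (x : ℝ) ^ (-(1 / 4) : ℝ)) atTop (𝓝 0) :=
    (tendsto_rpow_neg_atTop (by norm_num)).comp tendsto_natCast_atTop_atTop
  have key : ∀ᶠ x : ℕ in atTop, ((S ∩ Set.Icc 1 x).ncard : ℝ) / (x : ℝ) < ε := by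
    filter_upwards [hyt.eventually (eventually_primeCounting_le_mul hδ0),
      hyt.eventually_ge_atTop (M + 1), hlog.eventually_ge_atTop 2,
      hpow.eventually_lt_const (half_pos hε), eventually_gt_atTop 0] with x hπ hM hl hp hx0
    have hx : (0 : ℝ) < x := by exact_mod_cast hx0
    have hMk : M < ⌊y x⌋₊ + 1 := Nat.lt_succ_of_le (Nat.le_floor (by linarith))
    have hb := ncard_sylowAmbiguous_inter_le hMk x
    rw [Nat.add_sub_cancel] at hb
    have hmono : ((S ∩ Set.Icc 1 x).ncard : ℝ) ≤ (sylowAmbiguous M ∩ Set.Icc 1 x).ncard :=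
      Nat.cast_le.2 (Set.ncard_le_ncard (Set.inter_subset_inter_left _ hS)
        ((Set.finite_Icc 1 x).subset Set.inter_subset_right))
    have hsmooth : (2 : ℝ) ^ Nat.primeCounting ⌊y x⌋₊ * √x ≤ x * (x : ℝ) ^ (-(1 / 4) : ℝ) := by
      have h1 : (2 : ℝ) ^ Nat.primeCounting ⌊y x⌋₊ ≤ (x : ℝ) ^ (1 / 4 : ℝ) := by
        rw [Real.rpow_def_of_pos hx]
        have h2 : (2 : ℝ) ≤ Real.exp 1 := by linarith [Real.add_one_le_exp 1]
        calc (2 : ℝ) ^ Nat.primeCounting ⌊y x⌋₊ ≤ Real.exp 1 ^ Nat.primeCounting ⌊y x⌋₊ := by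
              gcongr
          _ = Real.exp (Nat.primeCounting ⌊y x⌋₊) := by rw [← Real.exp_nat_mul, mul_one]
          _ ≤ Real.exp (Real.log x * (1 / 4)) := by
              refine Real.exp_le_exp.2 (hπ.trans_eq ?_)
              simp only [hy]
              field_simp
      calc (2 : ℝ) ^ Nat.primeCounting ⌊y x⌋₊ * √x ≤ (x : ℝ) ^ (1 / 4 : ℝ) * √x := by gcongr
        _ = x * (x : ℝ) ^ (-(1 / 4) : ℝ) := by
            nth_rw 3 [← Real.rpow_one (x : ℝ)]
            rw [Real.sqrt_eq_rpow, ← Real.rpow_add hx, ← Real.rpow_add hx]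
            norm_num
    have hrough : (2 + Real.log x) * (2 / ((⌊y x⌋₊ + 1 : ℕ) : ℝ)) ≤ ε / 2 := by
      have hfl : y x ≤ ((⌊y x⌋₊ + 1 : ℕ) : ℝ) := by
        push_cast
        exact (Nat.lt_floor_add_one _).le
      have hy0 : 0 < y x := by positivity
      calc (2 + Real.log x) * (2 / ((⌊y x⌋₊ + 1 : ℕ) : ℝ))
          ≤ (Real.log x + Real.log x) * (2 / y x) := by gcongr
        _ = ε / 2 := by
            simp only [hy, hδ]
            field_simp
            norm_num
    rw [div_lt_iff₀ hx]
    nlinarith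
  obtain ⟨N, hN⟩ := eventually_atTop.1 key
  refine ⟨N, fun x hx => ?_⟩
  rw [Real.dist_0_eq_abs, abs_of_nonneg (by positivity)]
  exact hN x hx.le

/-! ### Normal subgroups of prime order in groups generated by involutions -/

/-- An involution acting on a group of prime order centralizes or inverts it. -/
theorem centralizes_or_inverts {G : Type*} [Group G] {P : Subgroup G} [hN : P.Normal]
    (hP : (Nat.card P).Prime) {a : G} (ha : a ^ 2 = 1) :
    a ∈ Subgroup.centralizer (P : Set G) ∨ ∀ x ∈ P, a * x * a⁻¹ = x⁻¹ := by
  have := Fact.mk hP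
  have hcyc : IsCyclic P := isCyclic_of_prime_card rfl
  have hcomm : ∀ x ∈ P, ∀ y ∈ P, x * y = y * x := fun x hx y hy =>
    congrArg Subtype.val (mul_comm' (⟨x, hx⟩ : P) ⟨y, hy⟩)
  -- The subgroup of `P` fixed by `a` is trivial or all of `P`.
  rcases ((Subgroup.centralizer {a}).subgroupOf P).eq_bot_or_eq_top_of_prime_card with h | h
  · refine Or.inr fun x hx => ?_
    have hax : a * x * a⁻¹ ∈ P := hN.conj_mem x hx a
    -- `a * x * a⁻¹ * x` is fixed by `a`, as `a` swaps its two commuting factors.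
    have hfix : (⟨a * x * a⁻¹ * x, mul_mem hax hx⟩ : P) ∈
        (Subgroup.centralizer {a}).subgroupOf P := by
      rw [Subgroup.mem_subgroupOf, Subgroup.mem_centralizer_singleton_iff]
      change a * x * a⁻¹ * x * a = a * (a * x * a⁻¹ * x)
      have h2 : a⁻¹ = a := inv_eq_of_mul_eq_one_right (by rw [← sq, ha])
      have h3 := hcomm _ hax x hx
      rw [h2] at h3 ⊢
      simp only [mul_assoc] at h3 ⊢
      rw [h3]
    rw [h, Subgroup.mem_bot, Subtype.ext_iff] at hfix
    exact eq_inv_of_mul_eq_one_left hfix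
  · refine Or.inl (Subgroup.mem_centralizer_iff.2 fun x hx => ?_)
    have hmem : (⟨x, hx⟩ : P) ∈ (Subgroup.centralizer {a}).subgroupOf P := h ▸ Subgroup.mem_top _
    rw [Subgroup.mem_subgroupOf, Subgroup.mem_centralizer_singleton_iff] at hmem
    exact hmem

theorem mul_mem_centralizer_of_inverts {G : Type*} [Group G] {P : Subgroup G}
    {a b : G} (ha : ∀ x ∈ P, a * x * a⁻¹ = x⁻¹) (hb : ∀ x ∈ P, b * x * b⁻¹ = x⁻¹) :
    a * b ∈ Subgroup.centralizer (P : Set G) := by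
  refine Subgroup.mem_centralizer_iff.2 fun x hx => ?_
  have h : a * b * x * (a * b)⁻¹ = x := by
    calc a * b * x * (a * b)⁻¹ = a * (b * x * b⁻¹) * a⁻¹ := by group
      _ = x := by rw [hb x hx, ha _ (inv_mem hx), inv_inv]
  exact (mul_inv_eq_iff_eq_mul.1 h).symm

/-- If `G` is generated by involutions whose pairwise products have order dividing `m`, then the
centralizer of a normal subgroup `P` of prime order is generated by elements of order dividing
`2 * m`. -/
theorem centralizer_le_closure_torsion {G : Type*} [Group G] {P : Subgroup G} [P.Normal]
    (hP : (Nat.card P).Prime) {A : Set G} (hA : Subgroup.closure A = ⊤)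
    (hinv : ∀ a ∈ A, a ^ 2 = 1) {m : ℕ} (hprod : ∀ a ∈ A, ∀ b ∈ A, (a * b) ^ m = 1) :
    Subgroup.centralizer (P : Set G) ≤
      Subgroup.closure {g | g ∈ Subgroup.centralizer (P : Set G) ∧ g ^ (2 * m) = 1} := by
  set C := Subgroup.centralizer (P : Set G) with hC
  set T : Set G := {g | g ∈ C ∧ g ^ (2 * m) = 1} with hT
  set H := Subgroup.closure T with hH
  have hHC : H ≤ C := (Subgroup.closure_le _).2 fun g hg => hg.1
  have hCn : C.Normal := inferInstance
  have hHn : H.Normal := by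
    refine ⟨fun w hw k => ?_⟩
    rw [← MulAut.conj_apply]
    refine (Subgroup.closure_le (H.comap (MulAut.conj k).toMonoidHom)).2 (fun g hg => ?_) hw
    exact Subgroup.subset_closure
      ⟨hCn.conj_mem g hg.1 k, (map_pow (MulAut.conj k) g _).symm.trans (by rw [hg.2, map_one])⟩
  have hmem : ∀ a ∈ A, a ∈ C → a ∈ H := fun a ha haC =>
    Subgroup.subset_closure ⟨haC, by rw [pow_mul, hinv a ha, one_pow]⟩
  have hmul : ∀ a ∈ A, a ∉ C → ∀ b ∈ A, b ∉ C → a * b ∈ H := fun a ha haC b hb hbC =>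
    Subgroup.subset_closure ⟨mul_mem_centralizer_of_inverts
      ((centralizes_or_inverts hP (hinv a ha)).resolve_left haC)
      ((centralizes_or_inverts hP (hinv b hb)).resolve_left hbC),
      by rw [mul_comm, pow_mul, hprod a ha b hb, one_pow]⟩
  by_cases hall : ∀ a ∈ A, a ∈ C
  · have : (⊤ : Subgroup G) ≤ H := hA ▸ (Subgroup.closure_le _).2 fun a ha => hmem a ha (hall a ha)
    exact le_top.trans this
  push Not at hall
  obtain ⟨g, hgA, hgC⟩ := hall
  -- All generators outside `C` are congruent to `g` modulo `H`, so `H` and `g⁻¹ H` cover `G`.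
  have hcover (w : G) : w ∈ H ∨ g * w ∈ H := by
    have hw : w ∈ Subgroup.closure A := by rw [hA]; exact Subgroup.mem_top w
    have hgg : g⁻¹ = g := inv_eq_of_mul_eq_one_right (by rw [← sq, hinv g hgA])
    induction hw using Subgroup.closure_induction with
    | mem a ha =>
      by_cases haC : a ∈ C
      · exact Or.inl (hmem a ha haC)
      · exact Or.inr (hmul g hgA hgC a ha haC)
    | one => exact Or.inl (one_mem H)
    | mul u v _ _ hu hv =>
      rcases hu with hu | hu <;> rcases hv with hv | hv
      · exact Or.inl (mul_mem hu hv)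
      · right
        have := mul_mem (hHn.conj_mem u hu g) hv
        rwa [mul_assoc (g * u), inv_mul_cancel_left, mul_assoc] at this
      · exact Or.inr (by rw [← mul_assoc]; exact mul_mem hu hv)
      · left
        have := mul_mem (hHn.conj_mem _ hu g⁻¹) hv
        rw [inv_inv, hgg] at this
        have h1 : g * (g * u) * g * (g * v) = u * v := by
          have h4 : g * g = 1 := by rw [← sq, hinv g hgA]
          calc g * (g * u) * g * (g * v) = (g * g) * u * (g * g) * v := by group
            _ = u * v := by rw [h4, one_mul, mul_one]
        rwa [h1] at this
    | inv u _ hu =>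
      refine hu.imp inv_mem fun hu => ?_
      have := hHn.conj_mem _ (inv_mem hu) g
      have h1 : g * (g * u)⁻¹ * g⁻¹ = g * u⁻¹ := by
        have h2 : g⁻¹ * g⁻¹ = 1 := by rw [← mul_inv_rev, ← sq, hinv g hgA, inv_one]
        rw [mul_inv_rev, mul_assoc, mul_assoc, h2, mul_one]
      rwa [h1] at this
  intro w hw
  refine (hcover w).resolve_right fun h => hgC ?_
  have := mul_mem (hHC h) (inv_mem hw)
  rwa [mul_inv_cancel_right] at this

open scoped IsMulCommutative in
/-- The transfer to the center is the power map with exponent the index of the center, so it is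
injective on a central subgroup `P` of prime order prime to its index. If the group is generated by
elements of order dividing `m`, the exponent of the image of the transfer divides `m`. -/
theorem card_dvd_of_closure_torsion {C : Type*} [Group C] [Finite C] {P : Subgroup C}
    (hPc : P ≤ Subgroup.center C) (hP : (Nat.card P).Prime) (hidx : ¬ Nat.card P ∣ P.index)
    {m : ℕ} (hgen : Subgroup.closure {g : C | g ^ m = 1} = ⊤) : Nat.card P ∣ m := by
  set f : C →* Subgroup.center C := MonoidHom.transferCenterPow C with hf
  have hker : Subgroup.closure {g : C | g ^ m = 1} ≤ ((powMonoidHom m).comp f).ker := by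
    refine (Subgroup.closure_le _).2 fun g hg => ?_
    rw [SetLike.mem_coe, MonoidHom.mem_ker, MonoidHom.comp_apply, powMonoidHom_apply, ← map_pow,
      show g ^ m = 1 from hg, map_one]
  have := Fact.mk hP
  obtain ⟨x, hx⟩ := exists_prime_orderOf_dvd_card' (G := P) (Nat.card P) dvd_rfl
  have h1 := hker (hgen ▸ Subgroup.mem_top (x : C))
  rw [MonoidHom.mem_ker, MonoidHom.comp_apply, powMonoidHom_apply, Subtype.ext_iff,
    Subgroup.coe_pow, MonoidHom.transferCenterPow_apply, Subgroup.coe_one, ← pow_mul] at h1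
  have h2 := orderOf_dvd_of_pow_eq_one h1
  rw [Subgroup.orderOf_coe, hx] at h2
  exact (hP.dvd_mul.1 h2).resolve_left fun h => hidx (h.trans (Subgroup.index_dvd_of_le hPc))

/-- If both alternatives fail, the Sylow `p`-subgroup is normal of order `p`, hence
central of index prime to `p` in its centralizer, which is generated by elements of order dividing
`2 * m`; so `p ∣ 2 * m`. -/
theorem sq_dvd_card_or_exists_dvd_card {G : Type*} [Group G] [Finite G] {A : Set G}
    (hA : Subgroup.closure A = ⊤) (hinv : ∀ a ∈ A, a ^ 2 = 1) {m : ℕ}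
    (hprod : ∀ a ∈ A, ∀ b ∈ A, (a * b) ^ m = 1) {p : ℕ} (hp : p.Prime) (hpG : p ∣ Nat.card G)
    (hpm : ¬ p ∣ 2 * m) :
    p * p ∣ Nat.card G ∨ ∃ d, 1 < d ∧ d ∣ Nat.card G ∧ d ≡ 1 [MOD p] := by
  have := Fact.mk hp
  refine or_iff_not_imp_left.2 fun hsq => ?_
  obtain ⟨P⟩ : Nonempty (Sylow p G) := inferInstance
  refine ⟨Nat.card (Sylow p G), ?_, P.card_dvd_index.trans (Subgroup.index_dvd_card _),
    card_sylow_modEq_one p G⟩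
  refine lt_of_le_of_ne Nat.card_pos fun h1 => hpm ?_
  have hPn : (P : Subgroup G).Normal := by
    have : Subsingleton (Sylow p G) := (Nat.card_eq_one_iff_unique.1 h1.symm).1
    exact Sylow.normal_of_subsingleton P
  have hcard : Nat.card P = p := by
    have hdvd : p ∣ Nat.card P := P.dvd_card_of_dvd_card hpG
    obtain ⟨k, hk⟩ := P.2.exists_card_eq
    have hk2 : k < 2 := by
      by_contra! h
      exact hsq (sq p ▸ (pow_dvd_pow p h).trans (hk ▸ Subgroup.card_subgroup_dvd_card _))
    interval_cases k
    · rw [hk] at hdvd; exact absurd (Nat.dvd_one.1 hdvd) hp.ne_one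
    · simpa using hk
  have hPp : (Nat.card (P : Subgroup G)).Prime := by rw [hcard]; exact hp
  set C := Subgroup.centralizer ((P : Subgroup G) : Set G) with hC
  have hPC : (P : Subgroup G) ≤ C := by
    have := Fact.mk hPp
    have hcyc : IsCyclic P := isCyclic_of_prime_card rfl
    exact fun x hx => Subgroup.mem_centralizer_iff.2 fun y hy =>
      congrArg Subtype.val (mul_comm' (⟨y, hy⟩ : P) ⟨x, hx⟩)
  have hQcard : Nat.card ((P : Subgroup G).subgroupOf C) = p := by
    rw [Nat.card_congr (Subgroup.subgroupOfEquivOfLe hPC).toEquiv, hcard]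
  refine hQcard.symm.dvd.trans (card_dvd_of_closure_torsion (fun x hx => Subgroup.mem_center_iff.2 fun y => Subtype.ext ?_)
    (by rw [hQcard]; exact hp) ?_ ?_)
  · exact (Subgroup.mem_centralizer_iff.1 y.2 x hx).symm
  · rw [hQcard]
    exact fun h => P.not_dvd_index (h.trans (Subgroup.relIndex_dvd_index_of_normal _ _))
  · refine Subgroup.map_injective C.subtype_injective (le_antisymm ?_ ?_)
    · exact Subgroup.map_mono le_top
    · rw [← MonoidHom.range_eq_map, Subgroup.range_subtype, MonoidHom.map_closure]
      refine (centralizer_le_closure_torsion hPp hA hinv hprod).trans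
        (Subgroup.closure_mono fun g hg => ⟨⟨g, hg.1⟩, Subtype.ext hg.2, rfl⟩)

/-! ### Quotients of full triangle groups -/

theorem fullTriangleGroup_of_mul_of_pow_eq_one (r s t : ℕ) (i j : Fin 3) :
    (PresentedGroup.of i * PresentedGroup.of j : FullTriangleGroup r s t) ^ (r * s * t) = 1 := by
  have hrel : ∀ w ∈ fullTriangleRels r s t,
      PresentedGroup.mk (fullTriangleRels r s t) w = 1 :=
    fun w hw => PresentedGroup.one_of_mem hw
  have hsq : ∀ k, (PresentedGroup.of k * PresentedGroup.of k : FullTriangleGroup r s t) = 1 := by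
    intro k
    rw [← sq]
    refine (map_pow _ _ _).symm.trans (hrel _ ?_)
    fin_cases k <;> simp [fullTriangleRels]
  have hinv : ∀ k, (PresentedGroup.of k : FullTriangleGroup r s t)⁻¹ = PresentedGroup.of k :=
    fun k => inv_eq_of_mul_eq_one_right (hsq k)
  have hlt : ∀ i j : Fin 3, i < j →
      (PresentedGroup.of i * PresentedGroup.of j : FullTriangleGroup r s t) ^ (r * s * t) = 1 := by
    have h01 : (PresentedGroup.of 0 * PresentedGroup.of 1 : FullTriangleGroup r s t) ^ r = 1 :=
      hrel ((FreeGroup.of 0 * FreeGroup.of 1) ^ r) (by simp [fullTriangleRels])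
    have h12 : (PresentedGroup.of 1 * PresentedGroup.of 2 : FullTriangleGroup r s t) ^ s = 1 :=
      hrel ((FreeGroup.of 1 * FreeGroup.of 2) ^ s) (by simp [fullTriangleRels])
    have h02 : (PresentedGroup.of 0 * PresentedGroup.of 2 : FullTriangleGroup r s t) ^ t = 1 :=
      hrel ((FreeGroup.of 0 * FreeGroup.of 2) ^ t) (by simp [fullTriangleRels])
    intro i j hij
    rw [← orderOf_dvd_iff_pow_eq_one] at h01 h12 h02 ⊢
    fin_cases i <;> fin_cases j <;> first | exact absurd hij (by decide) | skip
    · exact h01.trans ((dvd_mul_right r s).mul_right t)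
    · exact h02.trans (dvd_mul_left t _)
    · exact h12.trans ((dvd_mul_left s r).mul_right t)
  rcases lt_trichotomy i j with h | rfl | h
  · exact hlt i j h
  · rw [hsq, one_pow]
  · have h' := hlt j i h
    rw [← inv_eq_one, ← inv_pow, mul_inv_rev, hinv, hinv] at h'
    exact h'

theorem fullTriangleGroup_of_sq_eq_one (r s t : ℕ) (i : Fin 3) :
    (PresentedGroup.of i : FullTriangleGroup r s t) ^ 2 = 1 := by
  refine (map_pow _ _ _).symm.trans (PresentedGroup.one_of_mem ?_)
  fin_cases i <;> simp [fullTriangleRels]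

theorem finiteQuotientOrders_fullTriangleGroup_subset {r s t : ℕ} (hr : 0 < r) (hs : 0 < s)
    (ht : 0 < t) :
    finiteQuotientOrders (FullTriangleGroup r s t) ⊆ sylowAmbiguous (2 * (r * s * t)) := by
  rintro _ ⟨N, hN, hfin, rfl⟩ p hp hlt hdvd
  refine sq_dvd_card_or_exists_dvd_card
    (A := Set.range fun i => QuotientGroup.mk' N (PresentedGroup.of i)) ?_ ?_ ?_ hp hdvd
    (Nat.not_dvd_of_pos_of_lt (by positivity) hlt)
  · rw [Set.range_comp', ← MonoidHom.map_closure, PresentedGroup.closure_range_of,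
      ← MonoidHom.range_eq_map, MonoidHom.range_eq_top]
    exact QuotientGroup.mk'_surjective N
  · rintro _ ⟨i, rfl⟩
    rw [← map_pow, fullTriangleGroup_of_sq_eq_one, map_one]
  · rintro _ ⟨i, rfl⟩ _ ⟨j, rfl⟩
    rw [← map_mul, ← map_pow, fullTriangleGroup_of_mul_of_pow_eq_one, map_one]

theorem corollary2 (r s t : ℕ) (hr : 0 < r) (hs : 0 < s) (ht : 0 < t) :
    HasNaturalDensity (finiteQuotientOrders (FullTriangleGroup r s t)) 0 :=
  hasNaturalDensity_zero_of_subset_sylowAmbiguous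
    (finiteQuotientOrders_fullTriangleGroup_subset hr hs ht)
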